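/- Let $a,c,d\in\mathbb{Q}$ be nonzero, let $E: y^2=x^3+ax$ and $f(t)=t^4+ct+d$. For $t\in\mathbb{Q}$ with $f(t)\neq 0$ let $E^{f(t)}: f(t)\,y^2=x^3+ax$ be the quadratic twist of $E$ by $f(t)$, an elliptic curve over $\mathbb{Q}$ (with the point at infinity as identity). For $u\in\mathbb{Q}\setminus\{0\}$ put $\sigma(u)=(x(u),y(u),t(u))$ with $$x(u)=\frac{(d^2/c^4)u^8-2da\,u^4+c^4a^2}{u^6},\qquad y(u)=\frac{(-d/c^4)u^4+a}{u},\qquad t(u)=\frac{(-d/c)u^4+c^3a}{u^4},$$ so that $f(t(u))\,y(u)^2=x(u)^3+a\,x(u)$; that is, $(x(u),y(u))$ is a rational point of the fibre $E^{f(t(u))}$ whenever $f(t(u))\ne 0$. Then: 1. The set of $u\in\mathbb{Q}\setminus\{0\}$ with $f(t(u))\neq 0$ such that $\sigma(u)$ has infinite order in the group $E^{f(t(u))}(\mathbb{Q})$ is dense in $\mathbb{R}$. 2. Let $W$ be the set of $t\in\mathbb{Q}$ such that $f(t)\ne0$ and $E^{f(t)}(\mathbb{Q})$ has positive rank. Then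 $W$ is infinite. Moreover, every point of the half-line $(-d/c,\infty)$ is a limit of elements of $W$ if $ac>0$, and every point of the half-line $(-\infty,-d/c)$ is a limit of elements of $W$ if $ac<0$; that is, $W$ is dense in the respective half-line. -/

import Mathlib

/-- The quartic `f(t) = t⁴ + c t + d`. -/
def quarticF (c d t : ℚ) : ℚ := t ^ 4 + c * t + d

/-- Weierstrass model `Y² = X³ + a D² X` of the quadratic twist `E^D : D y² = x³ + a x` of
`E : y² = x³ + a x` (for `D ≠ 0`). The two models are identified by `(X, Y) = (D x, D² y)`,
the points at infinity corresponding to each other. -/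
def twistCurve (a D : ℚ) : WeierstrassCurve ℚ where
  a₁ := 0
  a₂ := 0
  a₃ := 0
  a₄ := a * D ^ 2
  a₆ := 0

/-- The Mordell-Weil group `E^D(ℚ)`, with Mathlib's group law. -/
abbrev TwistGroup (a D : ℚ) : Type := (twistCurve a D).toAffine.Point

/-- For `D ≠ 0`, `(x, y)` satisfies `D y² = x³ + a x` exactly when `(D x, D² y)` satisfies the
Weierstrass equation. -/
theorem twist_equation_iff {a D : ℚ} (hD : D ≠ 0) (x y : ℚ) :
    (twistCurve a D).toAffine.Equation (D * x) (D ^ 2 * y) ↔ D * y ^ 2 = x ^ 3 + a * x := by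
  rw [WeierstrassCurve.Affine.equation_iff]
  simp only [twistCurve]
  constructor
  · intro h
    have h3 : D ^ 3 ≠ 0 := pow_ne_zero 3 hD
    apply mul_left_cancel₀ h3
    linear_combination h
  · intro h
    linear_combination D ^ 3 * h

theorem twist_nonsingular {a D x y : ℚ} (ha : a ≠ 0) (hD : D ≠ 0)
    (h : D * y ^ 2 = x ^ 3 + a * x) :
    (twistCurve a D).toAffine.Nonsingular (D * x) (D ^ 2 * y) := by
  refine (WeierstrassCurve.Affine.equation_iff_nonsingular_of_Δ_ne_zero ?_).1
    ((twist_equation_iff hD x y).2 h)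
  have hΔ : (twistCurve a D).Δ = -64 * (a ^ 3 * D ^ 6) := by
    simp only [WeierstrassCurve.Δ, WeierstrassCurve.b₂, WeierstrassCurve.b₄,
      WeierstrassCurve.b₆, WeierstrassCurve.b₈, twistCurve]
    ring
  rw [show (twistCurve a D).toAffine.Δ = (twistCurve a D).Δ from rfl, hΔ]
  exact mul_ne_zero (by norm_num) (mul_ne_zero (pow_ne_zero 3 ha) (pow_ne_zero 6 hD))

/-- The point of the group `E^D(ℚ)` given by a rational solution of `D y² = x³ + a x`. -/
def twistPoint (a D x y : ℚ) (ha : a ≠ 0) (hD : D ≠ 0) (h : D * y ^ 2 = x ^ 3 + a * x) :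
    TwistGroup a D :=
  WeierstrassCurve.Affine.Point.some (D * x) (D ^ 2 * y) (twist_nonsingular ha hD h)

/-- The three coordinates of `σ(u) = (x(u), y(u), t(u))`, meaningful for `u ≠ 0`. -/
def sigmaX (a c d u : ℚ) : ℚ :=
  (d ^ 2 / c ^ 4 * u ^ 8 - 2 * d * a * u ^ 4 + c ^ 4 * a ^ 2) / u ^ 6

def sigmaY (a c d u : ℚ) : ℚ := (-d / c ^ 4 * u ^ 4 + a) / u

def sigmaT (a c d u : ℚ) : ℚ := (-d / c * u ^ 4 + c ^ 3 * a) / u ^ 4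

/-- `σ(u)` lies on the surface `f(t) y² = x³ + a x`. -/
theorem sigma_mem_surface {a c d u : ℚ} (hc : c ≠ 0) (hu : u ≠ 0) :
    quarticF c d (sigmaT a c d u) * sigmaY a c d u ^ 2
      = sigmaX a c d u ^ 3 + a * sigmaX a c d u := by
  simp only [quarticF, sigmaT, sigmaY, sigmaX]
  field_simp
  ring

/-- `σ(u)` as a point of the group of its fibre `E^{f(t(u))}`, when `u ≠ 0` and this fibre is
nondegenerate. -/
def sigmaPoint (a c d u : ℚ) (ha : a ≠ 0) (hc : c ≠ 0) (hu : u ≠ 0)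
    (hf : quarticF c d (sigmaT a c d u) ≠ 0) :
    TwistGroup a (quarticF c d (sigmaT a c d u)) :=
  twistPoint a (quarticF c d (sigmaT a c d u)) (sigmaX a c d u) (sigmaY a c d u) ha hf
    (sigma_mem_surface hc hu)

/-- The set of `t ∈ ℚ` such that `E^{f(t)}` is a (nondegenerate) twist of positive rank. The rank
is the cardinal-valued rank of the abelian group `E^{f(t)}(ℚ)`. -/
def positiveRankFibres (a c d : ℚ) : Set ℚ :=
  {t | quarticF c d t ≠ 0 ∧ 0 < Module.rank ℤ (TwistGroup a (quarticF c d t))}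

/-! The infinite order is detected 2-adically. If `|X|² > |A|`, the duplication formula `(X² - A)² /
(4(X³ + AX))` is governed by the powers of `X`, and the factor 4 in the denominator makes the norm
of the abscissa grow by exactly 4 (`padicNorm_duplication`). The condition persists, so the points
`2ⁿP` are pairwise distinct.

Since `x(u)` is the square of `(d/c²)u - c²a/u³`, the condition holds once `|u|₂` is large
(`padicNorm_sigmaX`), and such rationals are dense in `ℝ`. Finally `t(u) = -d/c + c³a/u⁴` is
continuous and maps the nonzero reals onto the half-line on the side of `-d/c` given by the sign of
`ac`, so density carries over to `W`. -/

/-- The `p`-adic norm of a sum is that of its dominant term. -/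
theorem padicNorm_add_eq_left {p : ℕ} [Fact p.Prime] {q r : ℚ}
    (h : padicNorm p r < padicNorm p q) : padicNorm p (q + r) = padicNorm p q := by
  rw [padicNorm.add_eq_max_of_ne h.ne', max_eq_left h.le]

theorem padicNorm_sub_eq_left {p : ℕ} [Fact p.Prime] {q r : ℚ}
    (h : padicNorm p r < padicNorm p q) : padicNorm p (q - r) = padicNorm p q := by
  rw [sub_eq_add_neg]
  exact padicNorm_add_eq_left (by rwa [padicNorm.neg])

theorem padicNorm_pow (p : ℕ) [Fact p.Prime] (q : ℚ) (n : ℕ) :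
    padicNorm p (q ^ n) = padicNorm p q ^ n := by
  induction n with
  | zero => simp
  | succ n ih => rw [pow_succ, padicNorm.mul, ih, pow_succ]

/-! ### Doubling and the 2-adic norm of the abscissa -/

/-- If `X` is 2-adically large compared with `A`, doubling on `Y² = X³ + A X` multiplies the 2-adic
norm of the abscissa by `4`. -/
theorem padicNorm_duplication {A X Y Z : ℚ} (hE : Y ^ 2 = X ^ 3 + A * X)
    (hX : padicNorm 2 A < padicNorm 2 X ^ 2) (hZ : Z * (4 * Y ^ 2) = (X ^ 2 - A) ^ 2) :
    padicNorm 2 Z = 4 * padicNorm 2 X := by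
  have h2 : padicNorm 2 2 = 2⁻¹ := by simpa using padicNorm.padicNorm_p_of_prime (p := 2)
  have h4 : padicNorm 2 4 = 4⁻¹ := by
    rw [show (4 : ℚ) = 2 ^ 2 by norm_num, padicNorm_pow, h2]; norm_num
  have hX' : padicNorm 2 A < padicNorm 2 (X ^ 2) := by rwa [padicNorm_pow]
  have hpos : padicNorm 2 X ≠ 0 := fun h0 =>
    absurd (padicNorm.nonneg (p := 2) A) (not_le.2 (by simpa [h0] using hX))
  have h := congrArg (padicNorm 2) hZ
  rw [hE, show X ^ 3 + A * X = X * (X ^ 2 + A) by ring, padicNorm.mul, padicNorm.mul,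
    padicNorm.mul, padicNorm_add_eq_left hX', padicNorm_pow _ (X ^ 2 - A),
    padicNorm_sub_eq_left hX', padicNorm_pow, h4] at h
  have h3 : padicNorm 2 X ^ 3 ≠ 0 := pow_ne_zero 3 hpos
  apply mul_right_cancel₀ h3
  linear_combination 4 * h

/-- The 2-adic norm of the abscissa of a point, with value `0` at infinity. -/
def abscissaNorm {a D : ℚ} : TwistGroup a D → ℚ
  | .zero => 0
  | .some X _ _ => padicNorm 2 X

theorem abscissaNorm_add_self {a D : ℚ} (P : TwistGroup a D)
    (hP : padicNorm 2 (a * D ^ 2) < abscissaNorm P ^ 2) :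
    abscissaNorm (P + P) = 4 * abscissaNorm P := by
  rcases P with _ | ⟨X, Y, h⟩
  · exact absurd (padicNorm.nonneg (p := 2) (a * D ^ 2))
      (not_le.2 (by simpa [abscissaNorm] using hP))
  · replace hP : padicNorm 2 (a * D ^ 2) < padicNorm 2 X ^ 2 := hP
    have hE : Y ^ 2 = X ^ 3 + a * D ^ 2 * X := by
      have := (WeierstrassCurve.Affine.equation_iff _ _).1 h.1
      simp only [twistCurve] at this
      linear_combination this
    -- If `Y = 0`, then `X = 0` or `X² = -aD²`; both contradict the strict dominance of `X²`.
    have hY : Y ≠ 0 := by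
      rintro rfl
      have hX' : padicNorm 2 (a * D ^ 2) < padicNorm 2 (X ^ 2) := by rwa [padicNorm_pow]
      have hX0 : X ≠ 0 := by
        rintro rfl
        exact absurd (padicNorm.nonneg (p := 2) (a * D ^ 2)) (not_le.2 (by simpa using hX'))
      have hs := padicNorm_add_eq_left hX'
      have h0 : X ^ 2 + a * D ^ 2 = 0 := by
        apply mul_left_cancel₀ hX0
        linear_combination -hE
      rw [h0, padicNorm.zero] at hs
      exact padicNorm.nonzero (pow_ne_zero 2 hX0) hs.symm
    have hYn : Y ≠ (twistCurve a D).toAffine.negY X Y := by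
      simp only [WeierstrassCurve.Affine.negY, twistCurve]
      intro hh
      exact hY (by linarith)
    rw [WeierstrassCurve.Affine.Point.add_self_of_Y_ne hYn]
    refine padicNorm_duplication hE hP ?_
    rw [WeierstrassCurve.Affine.slope_of_Y_ne rfl hYn]
    simp only [WeierstrassCurve.Affine.addX, WeierstrassCurve.Affine.negY, twistCurve]
    have hYY : Y - (-Y - 0 * X - 0) = 2 * Y := by ring
    rw [hYY]
    field_simp
    linear_combination (-32 * X) * hE

theorem abscissaNorm_two_pow_nsmul {a D : ℚ} (P : TwistGroup a D)
    (hP : padicNorm 2 (a * D ^ 2) < abscissaNorm P ^ 2) (n : ℕ) :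
    abscissaNorm (2 ^ n • P) = 4 ^ n * abscissaNorm P := by
  induction n with
  | zero => simp
  | succ n ih =>
    rw [pow_succ, mul_nsmul, two_nsmul, abscissaNorm_add_self, ih]
    · ring
    · rw [ih, mul_pow]
      -- Doubling only enlarges the abscissa norm, so the hypothesis survives the iteration.
      refine hP.trans_le (le_mul_of_one_le_left (sq_nonneg _) ?_)
      exact one_le_pow₀ (one_le_pow₀ (by norm_num))

/-- A point whose abscissa is 2-adically large has infinite order. -/
theorem not_isOfFinAddOrder_of_abscissaNorm {a D : ℚ} (P : TwistGroup a D)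
    (hP : padicNorm 2 (a * D ^ 2) < abscissaNorm P ^ 2) : ¬ IsOfFinAddOrder P := by
  have hpos : abscissaNorm P ≠ 0 := fun h0 =>
    absurd (padicNorm.nonneg (p := 2) (a * D ^ 2)) (not_le.2 (by simpa [h0] using hP))
  intro hfin
  have hinj : Function.Injective fun n : ℕ => 2 ^ n • P := by
    intro m n hmn
    have h := congrArg abscissaNorm hmn
    simp only [abscissaNorm_two_pow_nsmul P hP] at h
    exact Nat.pow_right_injective (le_refl 2 |>.trans (by norm_num : 2 ≤ 4))
      (by exact_mod_cast mul_right_cancel₀ hpos h)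
  have hsub : Set.range (fun n : ℕ => 2 ^ n • P) ⊆ (AddSubmonoid.multiples P : Set _) := by
    rintro _ ⟨n, rfl⟩
    exact ⟨2 ^ n, rfl⟩
  exact Set.infinite_range_of_injective hinj ((finite_multiples.2 hfin).subset hsub)

/-- Passing to the Weierstrass model multiplies both sides of `hx` by `|D|²`, so the criterion does
not depend on the twist. -/
theorem not_isOfFinAddOrder_twistPoint {a D x y : ℚ} (ha : a ≠ 0) (hD : D ≠ 0)
    (h : D * y ^ 2 = x ^ 3 + a * x) (hx : padicNorm 2 a < padicNorm 2 x ^ 2) :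
    ¬ IsOfFinAddOrder (twistPoint a D x y ha hD h) := by
  apply not_isOfFinAddOrder_of_abscissaNorm
  change padicNorm 2 (a * D ^ 2) < padicNorm 2 (D * x) ^ 2
  rw [padicNorm.mul, padicNorm.mul, padicNorm_pow, mul_pow, mul_comm]
  have hD0 : 0 < padicNorm 2 D := (padicNorm.nonneg D).lt_of_ne' (padicNorm.nonzero hD)
  exact mul_lt_mul_of_pos_left hx (by positivity)

/-! ### The points `σ(u)` for 2-adically large `u` -/

/-- For 2-adically large `u`, the abscissa `x(u)` is 2-adically large. -/
theorem padicNorm_sigmaX {a c d u : ℚ} (hc : c ≠ 0) (hu1 : 1 ≤ padicNorm 2 u)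
    (h1 : 1 ≤ padicNorm 2 (d / c ^ 2) * padicNorm 2 u)
    (ha : padicNorm 2 a < padicNorm 2 (d / c ^ 2) * padicNorm 2 u)
    (hca : padicNorm 2 (c ^ 2 * a) < padicNorm 2 (d / c ^ 2) * padicNorm 2 u) :
    padicNorm 2 a < padicNorm 2 (sigmaX a c d u) ^ 2 := by
  have hu : u ≠ 0 := by
    rintro rfl
    norm_num at hu1
  have hx : sigmaX a c d u = ((d / c ^ 2 * u ^ 4 - c ^ 2 * a) / u ^ 3) ^ 2 := by
    rw [sigmaX]
    field_simp
    ring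
  have hδ := padicNorm.nonneg (p := 2) (d / c ^ 2)
  have hlt : padicNorm 2 (c ^ 2 * a) < padicNorm 2 (d / c ^ 2 * u ^ 4) := by
    rw [padicNorm.mul (d / c ^ 2), padicNorm_pow]
    exact hca.trans_le (mul_le_mul_of_nonneg_left (le_self_pow₀ hu1 four_ne_zero) hδ)
  have hnorm : padicNorm 2 (sigmaX a c d u) = (padicNorm 2 (d / c ^ 2) * padicNorm 2 u) ^ 2 := by
    rw [hx, padicNorm_pow, padicNorm.div, padicNorm_sub_eq_left hlt, padicNorm.mul, padicNorm_pow,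
      padicNorm_pow]
    have hu' : padicNorm 2 u ≠ 0 := padicNorm.nonzero hu
    rw [show padicNorm 2 u ^ 4 = padicNorm 2 u * padicNorm 2 u ^ 3 by ring, ← mul_assoc,
      mul_div_cancel_right₀ _ (pow_ne_zero 3 hu')]
  rw [hnorm, ← pow_mul]
  exact ha.trans_le (le_self_pow₀ h1 (by norm_num))

/-- The parameters `u` for which `σ(u)` has infinite order in a nondegenerate fibre. -/
def infiniteOrderParameters (a c d : ℚ) (ha : a ≠ 0) (hc : c ≠ 0) : Set ℚ :=
  {u : ℚ | ∃ (hu : u ≠ 0) (hf : quarticF c d (sigmaT a c d u) ≠ 0),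
    ¬ IsOfFinAddOrder (sigmaPoint a c d u ha hc hu hf)}

theorem mem_infiniteOrderParameters {a c d u : ℚ} (ha : a ≠ 0) (hc : c ≠ 0) (hu : u ≠ 0)
    (hx : padicNorm 2 a < padicNorm 2 (sigmaX a c d u) ^ 2) :
    u ∈ infiniteOrderParameters a c d ha hc := by
  have hx0 : sigmaX a c d u ≠ 0 := by
    intro h0
    rw [h0, padicNorm.zero] at hx
    exact absurd (padicNorm.nonneg (p := 2) a) (not_le.2 (by simpa using hx))
  -- On a degenerate fibre `x(x² + a) = 0`, which dominance of `x²` again forbids.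
  have hf : quarticF c d (sigmaT a c d u) ≠ 0 := by
    intro h0
    have h := sigma_mem_surface (a := a) (d := d) hc hu
    rw [h0, zero_mul] at h
    rw [← padicNorm_pow] at hx
    have hs := padicNorm_add_eq_left hx
    have hz : sigmaX a c d u ^ 2 + a = 0 := by
      apply mul_left_cancel₀ hx0
      linear_combination -h
    rw [hz, padicNorm.zero] at hs
    exact padicNorm.nonzero (pow_ne_zero 2 hx0) hs.symm
  exact ⟨hu, hf, not_isOfFinAddOrder_twistPoint ha hf (sigma_mem_surface hc hu) hx⟩

/-! ### Density of the parameters `u` -/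

/-- The rationals of 2-adic norm at least `K` are dense in `ℝ`. -/
theorem dense_padicNorm_two_ge (K : ℚ) :
    Dense ((fun u : ℚ => (u : ℝ)) '' {u : ℚ | K ≤ padicNorm 2 u}) := by
  refine dense_of_exists_between fun x y hxy => ?_
  obtain ⟨n, hn⟩ := pow_unbounded_of_one_lt (max (K : ℝ) (3 / (y - x))) one_lt_two
  have hK : (K : ℝ) < 2 ^ n := (le_max_left _ _).trans_lt hn
  have h3 : 3 < 2 ^ n * (y - x) := (div_lt_iff₀ (sub_pos.2 hxy)).1 ((le_max_right _ _).trans_lt hn)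
  -- Since `2k ≤ 2ⁿx < 2k + 2`, the odd number `2k + 3` lies strictly above `2ⁿx` and at most 3
  -- beyond it, hence below `2ⁿy`; `2k + 1` could fall short.
  set k : ℤ := ⌊2 ^ n * x / 2⌋
  have hk1 : (k : ℝ) ≤ 2 ^ n * x / 2 := Int.floor_le _
  have hk2 : 2 ^ n * x / 2 < k + 1 := Int.lt_floor_add_one _
  have hpow : (0 : ℝ) < 2 ^ n := by positivity
  have hodd : padicNorm 2 ((2 * k + 3 : ℤ) : ℚ) = 1 := by
    rw [padicNorm.int_eq_one_iff]
    push_cast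
    omega
  have h2 : padicNorm 2 2 = 2⁻¹ := by simpa using padicNorm.padicNorm_p_of_prime (p := 2)
  refine ⟨_, ⟨((2 * k + 3 : ℤ) : ℚ) / 2 ^ n, ?_, rfl⟩, ?_, ?_⟩
  · rw [Set.mem_ofPred_eq, padicNorm.div, hodd, padicNorm_pow, h2, inv_pow, one_div, inv_inv]
    exact_mod_cast hK.le
  · push_cast
    rw [lt_div_iff₀ hpow]
    linarith
  · push_cast
    rw [div_lt_iff₀ hpow]
    linarith

theorem dense_infiniteOrderParameters {a c d : ℚ} (ha : a ≠ 0) (hc : c ≠ 0) (hd : d ≠ 0) :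
    Dense ((fun u : ℚ => (u : ℝ)) '' infiniteOrderParameters a c d ha hc) := by
  set δ := padicNorm 2 (d / c ^ 2)
  have hδ : 0 < δ :=
    (padicNorm.nonneg _).lt_of_ne' (padicNorm.nonzero (div_ne_zero hd (pow_ne_zero 2 hc)))
  have hA := padicNorm.nonneg (p := 2) a
  have hB := padicNorm.nonneg (p := 2) (c ^ 2 * a)
  -- This threshold forces `|u| ≥ 1` and makes `δ|u|` exceed `1`, `|a|` and `|c²a|` at once; the
  -- leading 1 also supplies strictness.
  refine (dense_padicNorm_two_ge
    (1 + (1 + padicNorm 2 a + padicNorm 2 (c ^ 2 * a)) / δ)).mono (Set.image_mono fun u hu => ?_)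
  have hu1 : 1 ≤ padicNorm 2 u := le_trans (le_add_of_nonneg_right (by positivity)) hu
  have hu2 : (1 + padicNorm 2 a + padicNorm 2 (c ^ 2 * a)) < δ * padicNorm 2 u := by
    rw [← div_lt_iff₀' hδ]
    exact lt_of_lt_of_le (lt_one_add _) hu
  refine mem_infiniteOrderParameters ha hc ?_
    (padicNorm_sigmaX hc hu1 (by linarith) (by linarith) (by linarith))
  rintro rfl
  norm_num at hu1

/-! ### Fibres of positive rank -/

theorem rank_pos_of_not_isOfFinAddOrder {G : Type*} [AddCommGroup G] {P : G}
    (hP : ¬ IsOfFinAddOrder P) : 0 < Module.rank ℤ G := by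
  rw [pos_iff_ne_zero]
  intro h0
  obtain ⟨n, hn, h⟩ := rank_eq_zero_iff.1 h0 P
  exact hP (isOfFinAddOrder_iff_zsmul_eq_zero.2 ⟨n, hn, h⟩)

theorem sigmaT_mem_positiveRankFibres {a c d u : ℚ} {ha : a ≠ 0} {hc : c ≠ 0}
    (hu : u ∈ infiniteOrderParameters a c d ha hc) :
    sigmaT a c d u ∈ positiveRankFibres a c d := by
  obtain ⟨_, hf, h⟩ := hu
  exact ⟨hf, rank_pos_of_not_isOfFinAddOrder h⟩

/-- The values of `t` on the nonzero reals are limits of parameters of fibres of positive rank. -/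
theorem mem_closure_positiveRankFibres {a c d : ℚ} (ha : a ≠ 0) (hc : c ≠ 0) (hd : d ≠ 0) {v : ℝ}
    (hv : v ≠ 0) :
    (-(d : ℝ) / c * v ^ 4 + (c : ℝ) ^ 3 * a) / v ^ 4 ∈
      closure ((fun t : ℚ => (t : ℝ)) '' positiveRankFibres a c d) := by
  have hcont : ContinuousAt (fun v : ℝ => (-(d : ℝ) / c * v ^ 4 + (c : ℝ) ^ 3 * a) / v ^ 4) v :=
    ContinuousAt.div (by fun_prop) (by fun_prop) (pow_ne_zero 4 hv)
  have himage := mem_closure_image hcont (dense_infiniteOrderParameters ha hc hd v)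
  refine closure_mono ?_ himage
  rintro _ ⟨_, ⟨u, hu, rfl⟩, rfl⟩
  exact ⟨_, sigmaT_mem_positiveRankFibres hu, by simp [sigmaT]⟩

/-- Every real `t` on the same side of `-d/c` as `c³a` is a limit of parameters of fibres of
positive rank. -/
theorem mem_closure_positiveRankFibres_of_pos {a c d : ℚ} (ha : a ≠ 0) (hc : c ≠ 0) (hd : d ≠ 0)
    {t : ℝ} (ht : 0 < (c : ℝ) ^ 3 * a / (t - -(d : ℝ) / c)) :
    t ∈ closure ((fun t : ℚ => (t : ℝ)) '' positiveRankFibres a c d) := by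
  -- `w` is the value of `u⁴` that solves `t(u) = t`; being positive, it has a real fourth root.
  set w := (c : ℝ) ^ 3 * a / (t - -(d : ℝ) / c) with hw
  have hs : t - -(d : ℝ) / c ≠ 0 := by
    intro h0
    simp [hw, h0] at ht
  have hv4 : √(√w) ^ 4 = w := by
    rw [show 4 = 2 * 2 from rfl, pow_mul, Real.sq_sqrt (Real.sqrt_nonneg w), Real.sq_sqrt ht.le]
  have hmem := mem_closure_positiveRankFibres ha hc hd
    (Real.sqrt_pos.2 (Real.sqrt_pos.2 ht)).ne'
  have hnum : (c : ℝ) ^ 3 * a = w * (t - -(d : ℝ) / c) := (div_mul_cancel₀ _ hs).symm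
  rw [hv4, hnum, show -(d : ℝ) / c * w + w * (t - -(d : ℝ) / c) = t * w by ring,
    mul_div_cancel_right₀ _ ht.ne'] at hmem
  exact hmem

theorem Ioi_subset_closure_positiveRankFibres {a c d : ℚ} (ha : a ≠ 0) (hc : c ≠ 0) (hd : d ≠ 0)
    (hac : 0 < a * c) : Set.Ioi (-(d : ℝ) / (c : ℝ)) ⊆
      closure ((fun t : ℚ => (t : ℝ)) '' positiveRankFibres a c d) := by
  intro t ht
  refine mem_closure_positiveRankFibres_of_pos ha hc hd (div_pos ?_ (sub_pos.2 ht))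
  have hac' : (0 : ℝ) < a * c := by exact_mod_cast hac
  have hc' : (c : ℝ) ≠ 0 := by exact_mod_cast hc
  rw [show (c : ℝ) ^ 3 * a = c ^ 2 * (a * c) by ring]
  positivity

theorem Iio_subset_closure_positiveRankFibres {a c d : ℚ} (ha : a ≠ 0) (hc : c ≠ 0) (hd : d ≠ 0)
    (hac : a * c < 0) : Set.Iio (-(d : ℝ) / (c : ℝ)) ⊆
      closure ((fun t : ℚ => (t : ℝ)) '' positiveRankFibres a c d) := by
  intro t ht
  refine mem_closure_positiveRankFibres_of_pos ha hc hd (div_pos_of_neg_of_neg ?_ (sub_neg.2 ht))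
  have hac' : (a * c : ℝ) < 0 := by exact_mod_cast hac
  have hc' : (c : ℝ) ≠ 0 := by exact_mod_cast hc
  rw [show (c : ℝ) ^ 3 * a = c ^ 2 * (a * c) by ring]
  exact mul_neg_of_pos_of_neg (by positivity) hac'

theorem infinite_positiveRankFibres {a c d : ℚ} (ha : a ≠ 0) (hc : c ≠ 0) (hd : d ≠ 0) :
    (positiveRankFibres a c d).Infinite := by
  intro hfin
  -- A finite set is closed, so its closure could not contain a half-line.
  have hcl : (closure ((fun t : ℚ => (t : ℝ)) '' positiveRankFibres a c d)).Finite := by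
    rw [(hfin.image _).isClosed.closure_eq]
    exact hfin.image _
  rcases (mul_ne_zero ha hc).lt_or_gt with h | h
  · exact Set.Iio_infinite _ (hcl.subset (Iio_subset_closure_positiveRankFibres ha hc hd h))
  · exact Set.Ioi_infinite _ (hcl.subset (Ioi_subset_closure_positiveRankFibres ha hc hd h))

theorem mainTheorem5 (a c d : ℚ) (ha : a ≠ 0) (hc : c ≠ 0) (hd : d ≠ 0) :
    Dense ((fun u : ℚ => (u : ℝ)) ''
      {u : ℚ | ∃ (hu : u ≠ 0) (hf : quarticF c d (sigmaT a c d u) ≠ 0),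
        ¬ IsOfFinAddOrder (sigmaPoint a c d u ha hc hu hf)}) ∧
    (positiveRankFibres a c d).Infinite ∧
    (0 < a * c → Set.Ioi (-(d : ℝ) / (c : ℝ)) ⊆
      closure ((fun t : ℚ => (t : ℝ)) '' positiveRankFibres a c d)) ∧
    (a * c < 0 → Set.Iio (-(d : ℝ) / (c : ℝ)) ⊆
      closure ((fun t : ℚ => (t : ℝ)) '' positiveRankFibres a c d)) := by
  exact ⟨dense_infiniteOrderParameters ha hc hd, infinite_positiveRankFibres ha hc hd,
    Ioi_subset_closure_positiveRankFibres ha hc hd, Iio_subset_closure_positiveRankFibres ha hc hd⟩
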